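/- **Proposition.** Let $n\ge 1$ be an integer and $d,\ell>0$. For $A\subset\mathbb C^n$ and $c\in\mathbb C^n$ put $$A_{d,c}=\{z\in A:\ |z-c|\le \tfrac12,\ \operatorname{dist}(z,\partial A)\ge \tfrac d2\}.$$ There exists $C>0$, depending only on $n$, $d$ and $\ell$, such that the following holds. Let $E\subset Y\subset X\subset\mathbb C^n$ be measurable sets with $|E|>0$, and suppose that for some invertible complex-affine map $D:\mathbb C^n\to\mathbb C^n$ 1. $\operatorname{diam} D(Y)=\tfrac14$; 2. $|D(Y)|\ge \ell$; 3. $\operatorname{dist}(\partial D(X),\partial D(Y))\ge d$; 4. for some $c\in\mathbb C^n$, the set $D(Y)$ is contained in a single connected component of $D(X)_{d,c}$ (given 1 and 3, this is automatic if $Y$ is connected, or if $X$ is convex, or if $d\ge\frac14$). Then for every $f\in A^2(X)$, that is, $f\in L^2(X)$ and $f$ is holomorphic in the interior of $X$, $$\langle f\rangle_{2,Y}\ \le\ C\,e^{C(N+1)S^*}\,\langle f\rangle_{2,E}.$$ Here $|\cdot|$ of a set is its Lebesgue measure, $\langle E\rangle_Y=|E|/|Y|$, $\langle f\rangle_{2,F}=\|f\|_{L^2(F)}/|F|^{1/2}$,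 $$N=\log\frac{\|f\|_{L^2(X)}}{\|f\|_{L^2(Y)}},\qquad S^*=\begin{cases}1+\log\frac1{\langle E\rangle_Y}, & n=1,\\[2pt] 1+\langle E\rangle_Y^{\frac1n-1}, & n\ge 2\end{cases}$$ (if $f=0$ almost everywhere on $Y$, both averages vanish and the inequality is trivial). -/

import Mathlib

open MeasureTheory

noncomputable section

/-- `ℂⁿ` with its Euclidean (Hermitian) norm; `volume` on it is the `2n`-dimensional Lebesgue
measure. -/
abbrev Cn (n : ℕ) : Type := EuclideanSpace ℂ (Fin n)

/-- Membership in the Bergman space `A²(X)`: square-integrable on `X` and holomorphic. A function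
is holomorphic on the measurable set `X` when it is so on the interior; for open `X` this is the
usual Bergman space. -/
def MemBergman2 {n : ℕ} (X : Set (Cn n)) (f : Cn n → ℂ) : Prop :=
  DifferentiableOn ℂ f (interior X) ∧ MemLp f 2 (volume.restrict X)

/-- The norm `‖f‖_{L²(F)}`. -/
def l2Norm {n : ℕ} (f : Cn n → ℂ) (F : Set (Cn n)) : ℝ :=
  (eLpNorm f 2 (volume.restrict F)).toReal

/-- The average `⟨f⟩_{2,F} = ‖f‖_{L²(F)} / |F|^{1/2}`. -/
def l2Avg {n : ℕ} (f : Cn n → ℂ) (F : Set (Cn n)) : ℝ :=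
  l2Norm f F / (volume F).toReal ^ ((1 : ℝ) / 2)

/-- The relative density `⟨E⟩_Y = |E| / |Y|`. -/
def density {n : ℕ} (E Y : Set (Cn n)) : ℝ :=
  (volume E).toReal / (volume Y).toReal

/-- The doubling index `N = log (‖f‖_{L²(X)} / ‖f‖_{L²(Y)})`. -/
def doublingIndex {n : ℕ} (f : Cn n → ℂ) (X Y : Set (Cn n)) : ℝ :=
  Real.log (l2Norm f X / l2Norm f Y)

/-- `S*`: it is `1 + log (1 / ⟨E⟩_Y)` for `n = 1` and `1 + ⟨E⟩_Y ^ (1/n - 1)` for `n ≥ 2`. -/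
def sStar {n : ℕ} (E Y : Set (Cn n)) : ℝ :=
  if n = 1 then 1 + Real.log (1 / density E Y)
  else 1 + density E Y ^ ((1 : ℝ) / (n : ℝ) - 1)

/-- `dist(∂A, ∂B) ≥ d`. -/
def BoundarySeparated {n : ℕ} (d : ℝ) (A B : Set (Cn n)) : Prop :=
  ∀ p ∈ frontier A, ∀ q ∈ frontier B, d ≤ dist p q

/-- The set obtained from `A` by restricting to the closed ball of radius `1/2` about `c` and
removing all open balls of radius `d/2` centred on `∂A`. -/
def innerSet {n : ℕ} (d : ℝ) (A : Set (Cn n)) (c : Cn n) : Set (Cn n) :=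
  {z | z ∈ A ∧ z ∈ Metric.closedBall c (1 / 2) ∧ ∀ p ∈ frontier A, d / 2 ≤ dist z p}

/-- `B` lies in one connected component of `innerSet d A c`, for some centre `c`. This holds, for
instance, when `dist(∂A, ∂B) ≥ d`, `B ⊆ A`, `diam B = 1/4`, and moreover `B` is connected, or `A`
is convex, or `d ≥ 1/4`. -/
def LiesInOneComponent {n : ℕ} (d : ℝ) (A B : Set (Cn n)) : Prop :=
  ∃ (c : Cn n) (W : Set (Cn n)), IsPreconnected W ∧ B ⊆ W ∧ W ⊆ innerSet d A c

end

/-! The core is a Remez inequality in one variable. Suppose `g` is bounded by `M` on a large circle,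
is at least `e^{-a} M` in size at the centre, and is at most `η` on a subset of a radius. Take the
divided difference of `g` at the centre and about `a` well-spaced points of that subset. As a
contour integral it is tiny, so the term at the centre must be balanced by the others, which are
controlled by `η`. This bounds `M` by `η` times an exponential that is linear in `a` and logarithmic
in the length of the subset (`le_mul_exp_of_small_on_real_set`).

In several variables, polar coordinates about a point where the function is large give a ray that
meets the small-value set in substantial length. The one-variable result on the complex line through
that ray gives a local Remez inequality (`exists_remez_const`). On a connected set of bounded size,
the same inequality propagates a lower bound from ball to ball of a finite cover, each step
multiplying the exponent by a fixed factor. The number of steps depends only on `n` and `d`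
(`exists_remez_const_of_isPreconnected`).

Finally, the sub-mean value property turns the `L²` norm on the big set into a sup bound, and
Chebyshev turns a small average on `E` into pointwise smallness on half of `E`. The averages, the
density and the doubling index are all invariant under the affine map. The argument yields `log (1 /
density)` in every dimension; for `n ≥ 2` this is dominated by the power in `sStar`. -/

/-! ### One-variable Remez inequality by divided differences. -/

/-- Hermite's formula for the divided difference: expand the reciprocal of the nodal polynomial in
partial fractions and apply Cauchy's formula to each term. -/
theorem sum_nodalWeight_mul_eq_circleIntegral {ι : Type*} [DecidableEq ι] {s : Finset ι}
    (hs : s.Nonempty) {v : ι → ℂ} (hv : Set.InjOn v s) {R : ℝ} (hvR : ∀ i ∈ s, v i ∈ Metric.ball 0 R)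
    {g : ℂ → ℂ} (hg : DiffContOnCl ℂ g (Metric.ball 0 R)) :
    ∑ i ∈ s, Lagrange.nodalWeight s v i * g (v i) =
      (2 * Real.pi * Complex.I : ℂ)⁻¹ • ∮ z in C(0, R), (∏ i ∈ s, (z - v i))⁻¹ * g z := by
  obtain ⟨i₀, hi₀⟩ := hs
  have hR : 0 < R := Metric.pos_of_mem_ball (hvR i₀ hi₀)
  have hne : ∀ z ∈ Metric.sphere (0 : ℂ) R, ∀ i ∈ s, z ≠ v i := by
    rintro z hz i hi rfl
    have h1 := hvR i hi
    rw [Metric.mem_ball] at h1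
    rw [Metric.mem_sphere] at hz
    exact absurd hz h1.ne
  have hcont : ContinuousOn g (Metric.sphere 0 R) :=
    hg.continuousOn_ball.mono Metric.sphere_subset_closedBall
  have hint : ∀ i ∈ s, CircleIntegrable (fun z => Lagrange.nodalWeight s v i *
      ((z - v i)⁻¹ * g z)) 0 R := fun i hi => by
    refine ContinuousOn.circleIntegrable hR.le (continuousOn_const.mul
      (ContinuousOn.mul (ContinuousOn.inv₀ (by fun_prop) fun z hz => ?_) hcont))
    exact sub_ne_zero.2 (hne z hz i hi)
  -- The partial fractions come from Lagrange interpolation of the constant `1`.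
  have hker : ∀ z ∈ Metric.sphere (0 : ℂ) R, (∏ i ∈ s, (z - v i))⁻¹ * g z =
      ∑ i ∈ s, Lagrange.nodalWeight s v i * ((z - v i)⁻¹ * g z) := fun z hz => by
    have h := Lagrange.eval_interpolate_not_at_node (s := s) (v := v) 1 (hne z hz)
    rw [Lagrange.interpolate_one hv ⟨i₀, hi₀⟩, Lagrange.eval_nodal] at h
    simp only [Polynomial.eval_one, Pi.one_apply, mul_one] at h
    rw [inv_eq_of_mul_eq_one_right h.symm, Finset.sum_mul]
    exact Finset.sum_congr rfl fun i _ => by ring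
  rw [circleIntegral.integral_congr hR.le hker, circleIntegral.integral_fun_sum hint,
    Finset.smul_sum]
  refine Finset.sum_congr rfl fun i hi => ?_
  rw [circleIntegral.integral_const_mul, ← hg.two_pi_i_inv_smul_circleIntegral_sub_inv_smul (hvR i hi)]
  simp only [smul_eq_mul]
  ring

/-- Greedy choice: skipping a gap of length `h` costs at most `h` of measure. The starting point
need not lie in `F`; later it is the centre, where the function is large. -/
theorem exists_spaced_points {h : ℝ} (hh : 0 < h) (m : ℕ) (a : ℝ) (F : Set ℝ)
    (hF : F ⊆ Set.Ici a) (hvol : ENNReal.ofReal (m * h) < volume F) :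
    ∃ t : ℕ → ℝ, t 0 = a ∧ ∀ i < m, t i + h ≤ t (i + 1) ∧ t (i + 1) ∈ F := by
  induction m generalizing a F with
  | zero => exact ⟨fun _ => a, rfl, fun i hi => absurd hi (by simp)⟩
  | succ m ih =>
    set G := F ∩ Set.Ici (a + h) with hG
    have hGvol : ENNReal.ofReal (m * h) < volume G := by
      have h1 : volume F ≤ ENNReal.ofReal h + volume G := by
        calc volume F ≤ volume (Set.Ico a (a + h) ∪ G) := measure_mono fun x hx => by
              by_cases hxa : x < a + h
              · exact Or.inl ⟨hF hx, hxa⟩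
              · exact Or.inr ⟨hx, not_lt.1 hxa⟩
          _ ≤ volume (Set.Ico a (a + h)) + volume G := measure_union_le _ _
          _ = _ := by rw [Real.volume_Ico]; simp
      rw [Nat.cast_succ, add_one_mul, ENNReal.ofReal_add (by positivity) hh.le, add_comm] at hvol
      exact (ENNReal.add_lt_add_iff_left ENNReal.ofReal_ne_top).1 (hvol.trans_le h1)
    obtain ⟨r, hr, hrG⟩ := ENNReal.lt_iff_exists_add_pos_lt.1 hGvol
    have hGne : G.Nonempty := nonempty_of_measure_ne_zero (pos_of_gt hGvol).ne'
    have hGbdd : BddBelow G := ⟨a + h, fun x hx => hx.2⟩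
    -- The infimum may not be attained, so the slack `r` in the strict measure bound pays for moving
    -- slightly past it.
    obtain ⟨b, hbG, hb⟩ := exists_lt_of_csInf_lt hGne (lt_add_of_pos_right (sInf G)
      (NNReal.coe_pos.2 hr))
    have hG' : ENNReal.ofReal (m * h) < volume (G ∩ Set.Ici b) := by
      have h1 : volume G ≤ volume (G ∩ Set.Ici b) + r := by
        calc volume G ≤ volume (G ∩ Set.Ici b ∪ Set.Ico (sInf G) b) := measure_mono fun x hx => by
              by_cases hxb : x < b
              · exact Or.inr ⟨csInf_le hGbdd hx, hxb⟩
              · exact Or.inl ⟨hx, not_lt.1 hxb⟩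
          _ ≤ volume (G ∩ Set.Ici b) + volume (Set.Ico (sInf G) b) := measure_union_le _ _
          _ ≤ _ := by
              rw [Real.volume_Ico]
              gcongr
              rw [ENNReal.ofReal_le_iff_le_toReal ENNReal.coe_ne_top, ENNReal.coe_toReal]
              linarith
      exact (ENNReal.add_lt_add_iff_right ENNReal.coe_ne_top).1 (hrG.trans_le h1)
    obtain ⟨t, ht0, ht⟩ := ih b (G ∩ Set.Ici b) Set.inter_subset_right hG'
    refine ⟨fun i => Nat.casesOn i a t, rfl, fun i hi => ?_⟩
    cases i with
    | zero =>
      simp only [ht0]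
      exact ⟨hbG.2, hbG.1⟩
    | succ i =>
      obtain ⟨h1, h2⟩ := ht i (by omega)
      exact ⟨h1, h2.1.1⟩

theorem mul_le_sub_of_spaced {h : ℝ} {m : ℕ} {t : ℕ → ℝ} (ht : ∀ i < m, t i + h ≤ t (i + 1))
    {i j : ℕ} (hij : i ≤ j) (hj : j ≤ m) : ((j : ℝ) - i) * h ≤ t j - t i := by
  induction j, hij using Nat.le_induction with
  | base => simp
  | succ j hij ih =>
    have := ih (by omega)
    have := ht j (by omega)
    push_cast
    linarith

theorem prod_erase_abs_sub (m i : ℕ) (hi : i ≤ m) :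
    ∏ k ∈ (Finset.range (m + 1)).erase i, |(i : ℝ) - k| = (i.factorial : ℝ) * (m - i).factorial := by
  induction m, hi using Nat.le_induction with
  | base =>
    rw [Finset.range_add_one, Finset.erase_insert (by simp)]
    simp only [Nat.sub_self, Nat.factorial_zero, Nat.cast_one, mul_one]
    rw [← Finset.prod_range_reflect, ← Finset.prod_range_add_one_eq_factorial, Nat.cast_prod]
    refine Finset.prod_congr rfl fun k hk => ?_
    have hk' := Finset.mem_range.1 hk
    rw [Nat.cast_sub (by omega), Nat.cast_sub (by omega)]
    push_cast
    rw [abs_of_nonneg] <;> linarith [(Nat.cast_nonneg k : (0:ℝ) ≤ k)]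
  | succ m hi ih =>
    rw [Finset.range_add_one, Finset.erase_insert_of_ne (by omega), Finset.prod_insert (by simp), ih,
      Nat.succ_sub hi, Nat.factorial_succ, abs_sub_comm, abs_of_nonneg]
    · push_cast [Nat.cast_sub hi]; ring
    · have : (i : ℝ) ≤ m := by exact_mod_cast hi
      push_cast; linarith

/-- Spacing at least `h` makes every product of differences at least that of the equally spaced
nodes, for which it is explicit. -/
theorem norm_nodalWeight_le {h : ℝ} (hh : 0 < h) {m : ℕ} {t : ℕ → ℝ}
    (ht : ∀ i < m, t i + h ≤ t (i + 1)) {i : ℕ} (hi : i ≤ m) :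
    ‖Lagrange.nodalWeight (Finset.range (m + 1)) (fun k => (t k : ℂ)) i‖ ≤
      (h ^ m)⁻¹ * ((i.factorial : ℝ) * (m - i).factorial)⁻¹ := by
  rw [Lagrange.nodalWeight, norm_prod, ← mul_inv]
  simp only [norm_inv]
  rw [Finset.prod_inv_distrib]
  have hcard : ((Finset.range (m + 1)).erase i).card = m := by
    rw [Finset.card_erase_of_mem (by simpa [Nat.lt_succ_iff] using hi)]; simp
  have hprod : h ^ m * ((i.factorial : ℝ) * (m - i).factorial) =
      ∏ k ∈ (Finset.range (m + 1)).erase i, h * |(i : ℝ) - k| := by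
    rw [Finset.prod_mul_distrib, Finset.prod_const, hcard, prod_erase_abs_sub m i hi]
  refine inv_anti₀ (by positivity) ?_
  rw [hprod]
  refine Finset.prod_le_prod (fun k _ => by positivity) fun k hk => ?_
  have hkm : k ≤ m := by
    have := Finset.mem_range.1 (Finset.mem_of_mem_erase hk); omega
  rw [← Complex.ofReal_sub, Complex.norm_real, Real.norm_eq_abs]
  rcases le_total k i with hki | hki
  · have := mul_le_sub_of_spaced ht hki hi
    have h1 : (k : ℝ) ≤ i := by exact_mod_cast hki
    rw [abs_of_nonneg (sub_nonneg.2 h1)]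
    exact (by linarith : _ ≤ t i - t k).trans (le_abs_self _)
  · have := mul_le_sub_of_spaced ht hki hkm
    have h1 : (i : ℝ) ≤ k := by exact_mod_cast hki
    rw [abs_sub_comm, abs_of_nonneg (sub_nonneg.2 h1), abs_sub_comm]
    exact (by linarith : _ ≤ t k - t i).trans (le_abs_self _)

theorem sum_inv_factorial_mul (m : ℕ) :
    ∑ i ∈ Finset.range (m + 1), ((i.factorial : ℝ) * (m - i).factorial)⁻¹ = 2 ^ m / m.factorial := by
  rw [eq_div_iff (by positivity), Finset.sum_mul]
  have := Nat.sum_range_choose m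
  rw [← Nat.cast_inj (R := ℝ)] at this
  push_cast at this
  rw [← this]
  refine Finset.sum_congr rfl fun i hi => ?_
  rw [Nat.cast_choose ℝ (by have := Finset.mem_range.1 hi; omega : i ≤ m)]
  field_simp

/-- In the divided difference the weight at `0` is at least `ρ⁻ᵐ`, while the contour integral is at
most `M (3ρ)⁻ᵐ`. The remaining nodes carry the factor `η`. -/
theorem norm_le_of_spaced_points {g : ℂ → ℂ} {R ρ h M η : ℝ} {m : ℕ} {t : ℕ → ℝ} (hρ : 0 < ρ)
    (hR : 4 * ρ ≤ R) (hh : 0 < h) (hη : 0 ≤ η)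
    (hg : DiffContOnCl ℂ g (Metric.ball 0 R)) (hgM : ∀ z ∈ Metric.sphere (0 : ℂ) R, ‖g z‖ ≤ M)
    (ht0 : t 0 = 0) (ht : ∀ i < m, t i + h ≤ t (i + 1)) (htρ : ∀ i ≤ m, t i ≤ ρ)
    (htη : ∀ i < m, ‖g (t (i + 1))‖ ≤ η) :
    ‖g 0‖ ≤ M * (1 / 3) ^ m + η * ((2 * ρ / h) ^ m / m.factorial) := by
  have hRpos : 0 < R := by linarith
  have htnn : ∀ i ≤ m, (i : ℝ) * h ≤ t i := fun i hi => by
    have := mul_le_sub_of_spaced ht (Nat.zero_le i) hi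
    rw [ht0] at this; simpa using this
  have htnn' : ∀ i ≤ m, 0 ≤ t i := fun i hi => le_trans (by positivity) (htnn i hi)
  set v : ℕ → ℂ := fun k => (t k : ℂ) with hv
  set s := Finset.range (m + 1) with hs
  have hmem : ∀ i ∈ s, i ≤ m := fun i hi => by have := Finset.mem_range.1 hi; omega
  have h0s : 0 ∈ s := by simp [hs]
  have hnv : ∀ i ∈ s, ‖v i‖ ≤ ρ := fun i hi => by
    rw [hv, Complex.norm_real, Real.norm_eq_abs, abs_of_nonneg (htnn' i (hmem i hi))]
    exact htρ i (hmem i hi)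
  have hinj : Set.InjOn v s := by
    intro i hi j hj hij
    have hij' : t i = t j := by simpa [hv] using hij
    rcases lt_trichotomy i j with hlt | heq | hlt
    · have := mul_le_sub_of_spaced ht hlt.le (hmem j hj)
      have h1 : (i : ℝ) < j := by exact_mod_cast hlt
      nlinarith
    · exact heq
    · have := mul_le_sub_of_spaced ht hlt.le (hmem i hi)
      have h1 : (j : ℝ) < i := by exact_mod_cast hlt
      nlinarith
  have hvR : ∀ i ∈ s, v i ∈ Metric.ball 0 R := fun i hi => by
    rw [mem_ball_zero_iff]; linarith [hnv i hi]
  have key := sum_nodalWeight_mul_eq_circleIntegral ⟨0, h0s⟩ hinj hvR hg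
  -- On the circle the node `0` contributes exactly `R`, cancelling the radius; each other node
  -- contributes at least `R - ρ ≥ 3ρ`.
  have hbound : ‖(2 * Real.pi * Complex.I : ℂ)⁻¹ • ∮ z in C(0, R), (∏ i ∈ s, (z - v i))⁻¹ * g z‖ ≤
      R * ((R * (3 * ρ) ^ m)⁻¹ * M) := by
    refine circleIntegral.norm_two_pi_i_inv_smul_integral_le_of_norm_le_const hRpos.le fun z hz => ?_
    rw [norm_mul, norm_inv, norm_prod]
    have hz' : ‖z‖ = R := by simpa using hz
    refine mul_le_mul (inv_anti₀ (by positivity) ?_) (hgM z hz) (norm_nonneg _) (by positivity)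
    rw [hs, Finset.prod_range_succ', mul_comm]
    have h0 : ‖z - v 0‖ = R := by simp [hv, ht0, hz']
    rw [h0]
    refine mul_le_mul_of_nonneg_right ?_ hRpos.le
    have : (3 * ρ) ^ m = ∏ _k ∈ Finset.range m, 3 * ρ := by simp
    rw [this]
    refine Finset.prod_le_prod (fun k _ => by positivity) fun k hk => ?_
    have h1 := norm_sub_norm_le z (v (k + 1))
    have h2 := hnv (k + 1) (by simpa [hs] using hk)
    linarith
  have hw0 : (ρ ^ m)⁻¹ ≤ ‖Lagrange.nodalWeight s v 0‖ := by
    rw [Lagrange.nodalWeight, norm_prod]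
    simp only [norm_inv]
    rw [Finset.prod_inv_distrib]
    have hpos : ∀ k ∈ s.erase 0, 0 < ‖v 0 - v k‖ := fun k hk => by
      rw [norm_pos_iff, sub_ne_zero]
      exact fun he => Finset.ne_of_mem_erase hk (hinj h0s (Finset.mem_of_mem_erase hk) he).symm
    refine inv_anti₀ (Finset.prod_pos hpos) ?_
    have hcard : (s.erase 0).card = m := by rw [Finset.card_erase_of_mem h0s]; simp [hs]
    calc ∏ k ∈ s.erase 0, ‖v 0 - v k‖ ≤ ∏ _k ∈ s.erase 0, ρ :=
          Finset.prod_le_prod (fun k _ => norm_nonneg _) fun k hk => by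
            have : v 0 = 0 := by simp [hv, ht0]
            rw [this, zero_sub, norm_neg]
            exact hnv k (Finset.mem_of_mem_erase hk)
      _ = ρ ^ m := by rw [Finset.prod_const, hcard]
  have hrest : ‖∑ i ∈ s.erase 0, Lagrange.nodalWeight s v i * g (v i)‖ ≤
      (h ^ m)⁻¹ * (2 ^ m / m.factorial) * η := by
    calc _ ≤ ∑ i ∈ s.erase 0, ((h ^ m)⁻¹ * ((i.factorial : ℝ) * (m - i).factorial)⁻¹) * η := by
          refine norm_sum_le_of_le _ fun i hi => ?_
          have hi1 := Finset.mem_of_mem_erase hi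
          have hi0 := Finset.ne_of_mem_erase hi
          obtain ⟨j, rfl⟩ := Nat.exists_eq_succ_of_ne_zero hi0
          rw [norm_mul]
          exact mul_le_mul (norm_nodalWeight_le hh ht (hmem _ hi1))
            (htη j (by have := hmem _ hi1; omega)) (norm_nonneg _) (by positivity)
      _ ≤ ∑ i ∈ s, ((h ^ m)⁻¹ * ((i.factorial : ℝ) * (m - i).factorial)⁻¹) * η :=
          Finset.sum_le_sum_of_subset_of_nonneg (Finset.erase_subset _ _)
            fun _ _ _ => by positivity
      _ = _ := by rw [← Finset.sum_mul, ← Finset.mul_sum, sum_inv_factorial_mul]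
  rw [← Finset.add_sum_erase _ _ h0s] at key
  have hv0 : v 0 = 0 := by simp [hv, ht0]
  have h1 : ‖Lagrange.nodalWeight s v 0‖ * ‖g 0‖ ≤
      R * ((R * (3 * ρ) ^ m)⁻¹ * M) + (h ^ m)⁻¹ * (2 ^ m / m.factorial) * η := by
    rw [← norm_mul, ← hv0, eq_sub_of_add_eq key]
    exact (norm_sub_le _ _).trans (add_le_add hbound hrest)
  have h2 := (mul_le_mul_of_nonneg_right hw0 (norm_nonneg (g 0))).trans h1
  rw [inv_mul_le_iff₀ (by positivity)] at h2
  refine h2.trans_eq ?_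
  rw [mul_pow, div_pow, div_pow, mul_pow, one_pow]
  field_simp

theorem le_mul_exp_of_small_on_real_set {g : ℂ → ℂ} {R ρ σ M η a : ℝ} {F : Set ℝ} (hσ : 0 < σ)
    (hσρ : σ ≤ ρ) (hR : 4 * ρ ≤ R) (hM : 0 ≤ M) (hη : 0 ≤ η) (ha : 0 ≤ a)
    (hg : DiffContOnCl ℂ g (Metric.ball 0 R)) (hgM : ∀ z ∈ Metric.sphere (0 : ℂ) R, ‖g z‖ ≤ M)
    (hF : F ⊆ Set.Icc 0 ρ) (hFσ : ENNReal.ofReal σ ≤ volume F) (hFη : ∀ t ∈ F, ‖g (t : ℂ)‖ ≤ η)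
    (hg0 : Real.exp (-a) * M ≤ ‖g 0‖) :
    M ≤ η * Real.exp (8 * (a + 1) * (1 + Real.log (ρ / σ))) := by
  have hρ : 0 < ρ := hσ.trans_le hσρ
  -- Enough nodes that `3⁻ᵐ ≤ e^{-a} / 2`, so that the contour term absorbs at most half of the
  -- lower bound at `0`.
  set m : ℕ := ⌈a⌉₊ + 1 with hm
  have hma : a + 1 ≤ m := by rw [hm]; push_cast; linarith [Nat.le_ceil a]
  have hma' : (m : ℝ) ≤ a + 2 := by rw [hm]; push_cast; linarith [Nat.ceil_lt_add_one ha]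
  have hmpos : (0 : ℝ) < m := by linarith
  -- With this spacing `m * h = σ / 2` is strictly below the measure of `F`, and `mᵐ / m! ≤ eᵐ`
  -- absorbs the factor `m` in `1 / h`.
  set h := σ / (2 * m) with hh
  have hhpos : 0 < h := by positivity
  have hmh : (m : ℝ) * h = σ / 2 := by rw [hh]; field_simp
  obtain ⟨t, ht0, ht⟩ := exists_spaced_points hhpos m 0 F (fun x hx => (hF hx).1) (by
    rw [hmh]
    exact ((ENNReal.ofReal_lt_ofReal_iff hσ).2 (by linarith)).trans_le hFσ)
  have hkey := norm_le_of_spaced_points hρ hR hhpos hη hg hgM ht0 (fun i hi => (ht i hi).1)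
    (fun i hi => by
      cases i with
      | zero => rw [ht0]; exact hρ.le
      | succ i => exact (hF (ht i (by omega)).2).2) (fun i hi => hFη _ (ht i hi).2)
  set Λ := Real.log (ρ / σ) with hΛ
  have hΛ0 : 0 ≤ Λ := Real.log_nonneg ((one_le_div hσ).2 hσρ)
  have h4 : (4 : ℝ) ≤ Real.exp 2 := by
    have h1 := Real.add_one_le_exp (1 : ℝ)
    have h2 : Real.exp 2 = Real.exp 1 * Real.exp 1 := by rw [← Real.exp_add]; norm_num
    nlinarith
  have hfac : (2 * ρ / h) ^ m / m.factorial ≤ Real.exp (m * (3 + Λ)) := by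
    have e1 : 2 * ρ / h = (4 * (ρ / σ)) * m := by rw [hh]; field_simp; ring
    rw [e1, mul_pow, mul_div_assoc]
    calc (4 * (ρ / σ)) ^ m * ((m : ℝ) ^ m / m.factorial) ≤
          (Real.exp 2 * Real.exp Λ) ^ m * Real.exp m := by
          rw [hΛ, Real.exp_log (by positivity)]
          gcongr
          exact Real.pow_div_factorial_le_exp _ hmpos.le _
      _ = _ := by
          rw [← Real.exp_add, ← Real.exp_nat_mul, ← Real.exp_add]; congr 1; ring
  have hthird : (1 / 3 : ℝ) ^ m ≤ Real.exp (-a) * (1 / 2) := by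
    have h1 : (1 / 3 : ℝ) ≤ Real.exp (-1) := by
      rw [Real.exp_neg, one_div]
      exact inv_anti₀ (Real.exp_pos _) Real.exp_one_lt_three.le
    have h2 : Real.exp (-1) ≤ 1 / 2 := by
      rw [Real.exp_neg, one_div]
      exact inv_anti₀ (by norm_num) (by linarith [Real.add_one_le_exp (1 : ℝ)])
    calc (1 / 3 : ℝ) ^ m ≤ Real.exp (-1) ^ m := by gcongr
      _ = Real.exp (-m) := by rw [← Real.exp_nat_mul]; ring_nf
      _ ≤ Real.exp (-a + -1) := Real.exp_le_exp.2 (by linarith)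
      _ ≤ _ := by rw [Real.exp_add]; gcongr
  have h1 : Real.exp (-a) * M ≤ M * (Real.exp (-a) * (1 / 2)) + η * Real.exp (m * (3 + Λ)) :=
    (hg0.trans hkey).trans (by gcongr)
  have h2 : M ≤ 2 * Real.exp a * (η * Real.exp (m * (3 + Λ))) := by
    have h3 : Real.exp (-a) * M ≤ 2 * (η * Real.exp (m * (3 + Λ))) := by linarith
    rw [Real.exp_neg, inv_mul_le_iff₀ (Real.exp_pos a)] at h3
    linarith
  refine h2.trans ?_
  calc 2 * Real.exp a * (η * Real.exp (m * (3 + Λ)))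
      ≤ Real.exp 1 * Real.exp a * (η * Real.exp ((a + 2) * (3 + Λ))) := by
        have := Real.add_one_le_exp (1 : ℝ)
        gcongr
        linarith
    _ = η * Real.exp (1 + a + (a + 2) * (3 + Λ)) := by
        rw [Real.exp_add, Real.exp_add]; ring
    _ ≤ _ := by
        gcongr
        nlinarith [mul_nonneg ha hΛ0]

/-! ### Slicing by rays and the local Remez inequality in several variables. -/

/-- Polar coordinates: inside the ball the radial density is at most `ρ ^ (dim - 1)`. -/
theorem measure_le_of_forall_ray_le {V : Type*} [NormedAddCommGroup V] [NormedSpace ℝ V]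
    [FiniteDimensional ℝ V] [MeasurableSpace V] [BorelSpace V] (μ : Measure V) [μ.IsAddHaarMeasure]
    [Nontrivial V] {S : Set V} (hS : MeasurableSet S) {ρ : ℝ} (hSρ : S ⊆ Metric.ball 0 ρ)
    {c : ENNReal} (hc : ∀ v : V, ‖v‖ = 1 → volume {t : ℝ | t ∈ Set.Icc 0 ρ ∧ t • v ∈ S} ≤ c) :
    μ S ≤ ENNReal.ofReal (ρ ^ (Module.finrank ℝ V - 1)) * c * μ.toSphere Set.univ := by
  set Φ := homeomorphUnitSphereProd V with hΦ
  set ν := Measure.volumeIoiPow (Module.finrank ℝ V - 1) with hν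
  set T : Set (Metric.sphere (0 : V) 1 × Set.Ioi (0 : ℝ)) := {x | x.2.1 • x.1.1 ∈ S} with hT
  have hTm : MeasurableSet T := by
    have h1 : Continuous fun x : Metric.sphere (0 : V) 1 × Set.Ioi (0 : ℝ) => x.2.1 • x.1.1 := by
      fun_prop
    exact h1.measurable hS
  have hpre : Φ ⁻¹' T = Subtype.val ⁻¹' S := by
    ext x
    have hx : ‖x.1‖ ≠ 0 := norm_ne_zero_iff.2 x.2
    simp [hT, hΦ, smul_smul, hx]
  have h0 : μ S = (μ.toSphere.prod ν) T := by
    rw [← μ.measurePreserving_homeomorphUnitSphereProd.measure_preimage hTm.nullMeasurableSet, hpre,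
      comap_subtype_coe_apply (measurableSet_singleton _).compl, Subtype.image_preimage_coe,
      Set.inter_comm, ← Set.sdiff_eq, measure_sdiff_null (measure_singleton _)]
  rw [h0, Measure.prod_apply hTm, ← lintegral_const]
  refine lintegral_mono fun v => ?_
  have hv : ‖v.1‖ = 1 := by simp
  have hTv : MeasurableSet (Prod.mk v ⁻¹' T) := hTm.preimage measurable_prodMk_left
  have hlt : ∀ r ∈ Prod.mk v ⁻¹' T, r.1 < ρ := fun r hr => by
    have h1 : r.1 • v.1 ∈ S := hr
    have h2 := hSρ h1
    rw [mem_ball_zero_iff, norm_smul, hv, mul_one, Real.norm_eq_abs, abs_of_pos r.2] at h2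
    exact h2
  rw [hν, Measure.volumeIoiPow, withDensity_apply _ hTv]
  calc _ ≤ ∫⁻ _r in Prod.mk v ⁻¹' T, ENNReal.ofReal (ρ ^ (Module.finrank ℝ V - 1))
          ∂(Measure.comap Subtype.val volume) := by
        refine setLIntegral_mono measurable_const fun r hr => ENNReal.ofReal_le_ofReal ?_
        have h3 : (0 : ℝ) < r.1 := r.2
        gcongr
        exact (hlt r hr).le
    _ = ENNReal.ofReal (ρ ^ (Module.finrank ℝ V - 1)) * volume (Subtype.val '' (Prod.mk v ⁻¹' T)) := by
        rw [setLIntegral_const, comap_subtype_coe_apply measurableSet_Ioi]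
    _ ≤ _ := by
        gcongr
        refine (measure_mono ?_).trans (hc v.1 hv)
        rintro _ ⟨r, hr, rfl⟩
        exact ⟨⟨(Set.mem_Ioi.1 r.2).le, (hlt r hr).le⟩, hr⟩

/-- Local Remez inequality for holomorphic functions of several variables, with the measure of the
small set compared to its maximal possible value up to a dimensional factor. -/
theorem exists_remez_const (n : ℕ) (hn : 1 ≤ n) (ρ : ℝ) (hρ : 0 < ρ) :
    ∃ K : ℝ, 0 < K ∧ ∀ (h : Cn n → ℂ) (p : Cn n) (S : Set (Cn n)) (M η a s : ℝ),
      0 ≤ M → 0 ≤ η → 0 ≤ a → 0 < s → s ≤ 1 →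
      DifferentiableOn ℂ h (Metric.ball p (5 * ρ)) → (∀ x ∈ Metric.ball p (5 * ρ), ‖h x‖ ≤ M) →
      Real.exp (-a) * M ≤ ‖h p‖ → MeasurableSet S → S ⊆ Metric.ball p ρ →
      ENNReal.ofReal s ≤ volume S → (∀ x ∈ S, ‖h x‖ ≤ η) →
      M ≤ η * Real.exp (K * (a + 1) * (1 + Real.log (1 / s))) := by
  have : Nonempty (Fin n) := ⟨⟨0, hn⟩⟩
  have : Nontrivial (Cn n) := inferInstance
  set σ := ((volume : Measure (Cn n)).toSphere Set.univ).toReal with hσ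
  have hσpos : 0 < σ := ENNReal.toReal_pos
    (Measure.measure_univ_ne_zero.2 (Measure.toSphere_ne_zero _)) (measure_ne_top _ _)
  set k := ρ ^ (Module.finrank ℝ (Cn n) - 1) * σ with hk
  have hkpos : 0 < k := by positivity
  -- If every ray met `S` in length at most `κ * s`, then `|S| ≤ k * κ * s ≤ s / 2`, a
  -- contradiction. The cap at `ρ` ensures `κ * s ≤ ρ`.
  set κ := min (1 / (2 * k)) ρ with hκ
  have hκpos : 0 < κ := by positivity
  have hκρ : κ ≤ ρ := min_le_right _ _
  set Λ := Real.log (ρ / κ) with hΛ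
  have hΛ0 : 0 ≤ Λ := Real.log_nonneg ((one_le_div hκpos).2 hκρ)
  refine ⟨8 * (1 + Λ), by positivity, ?_⟩
  intro h p S M η a s hM hη ha hs hs1 hd hhM hp hS hSp hSs hSη
  obtain ⟨v, hv, hvol⟩ : ∃ v : Cn n, ‖v‖ = 1 ∧ ENNReal.ofReal (κ * s) ≤
      volume {t : ℝ | t ∈ Set.Icc 0 ρ ∧ t • v ∈ (fun x => p + x) ⁻¹' S} := by
    by_contra! hcon
    have h1 := measure_le_of_forall_ray_le (volume : Measure (Cn n))
      (S := (fun x => p + x) ⁻¹' S) (hS.preimage (measurable_const_add p)) (ρ := ρ)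
      (fun x hx => by simpa using hSp hx) (fun v hv => (hcon v hv).le)
    rw [measure_preimage_add, ← ENNReal.ofReal_toReal (measure_ne_top _ Set.univ), ← hσ,
      ← ENNReal.ofReal_mul (by positivity), ← ENNReal.ofReal_mul (by positivity)] at h1
    have h2 := (ENNReal.ofReal_le_ofReal_iff (by positivity)).1 (hSs.trans h1)
    have h3 : κ * k ≤ 1 / 2 := by
      calc κ * k ≤ 1 / (2 * k) * k := by gcongr; exact min_le_left _ _
        _ = 1 / 2 := by field_simp
    have h4 : ρ ^ (Module.finrank ℝ (Cn n) - 1) * (κ * s) * σ = κ * k * s := by rw [hk]; ring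
    rw [h4] at h2
    nlinarith
  have hline : ∀ z : ℂ, ‖z‖ < 5 * ρ → p + z • v ∈ Metric.ball p (5 * ρ) := fun z hz => by
    rw [mem_ball_iff_norm, add_sub_cancel_left, norm_smul, hv, mul_one]; exact hz
  have hgd : DifferentiableOn ℂ (fun z : ℂ => h (p + z • v)) (Metric.ball 0 (5 * ρ)) :=
    hd.comp (by fun_prop) fun z hz => hline z (by simpa using hz)
  have hsub : Metric.closedBall (0 : ℂ) (4 * ρ) ⊆ Metric.ball 0 (5 * ρ) :=
    Metric.closedBall_subset_ball (by linarith)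
  have key := le_mul_exp_of_small_on_real_set (g := fun z : ℂ => h (p + z • v)) (R := 4 * ρ)
    (ρ := ρ) (σ := κ * s) (by positivity) (by nlinarith) le_rfl hM hη ha
    ((hgd.mono hsub).diffContOnCl_ball le_rfl)
    (fun z hz => hhM _ (hline z (by
      have : ‖z‖ = 4 * ρ := by simpa using hz
      linarith))) (fun t ht => ht.1) hvol
    (fun t ht => hSη _ (by simpa using ht.2)) (by simpa using hp)
  refine key.trans ?_
  have e1 : Real.log (ρ / (κ * s)) = Λ + Real.log (1 / s) := by
    rw [hΛ, ← Real.log_mul (by positivity) (by positivity)]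
    congr 1
    field_simp
  have hl : 0 ≤ Real.log (1 / s) := Real.log_nonneg ((one_le_div hs).2 hs1)
  rw [e1]
  refine mul_le_mul_of_nonneg_left (Real.exp_le_exp.2 ?_) hη
  have : 1 + (Λ + Real.log (1 / s)) ≤ (1 + Λ) * (1 + Real.log (1 / s)) := by nlinarith
  nlinarith [mul_le_mul_of_nonneg_left this (by positivity : 0 ≤ 8 * (a + 1))]

/-! ### Sub-mean value property on balls. -/

/-- For each `x` in the centred ball, `h(p)²` is the average of `h(p + e^{iθ} x)²` over `θ`.
Integrating in `x`, Fubini and invariance of volume under `x ↦ e^{iθ} x` remove the rotation. -/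
theorem enorm_sq_mul_volume_ball_le {n : ℕ} {h : Cn n → ℂ} {p : Cn n} {r : ℝ}
    (hd : DifferentiableOn ℂ h (Metric.ball p r)) :
    ‖h p‖ₑ ^ 2 * volume (Metric.ball p r) ≤ ∫⁻ x in Metric.ball p r, ‖h x‖ₑ ^ 2 := by
  set B := Metric.ball (0 : Cn n) r with hB
  set u : Cn n → ENNReal := B.indicator fun x => ‖h (p + x)‖ₑ ^ 2 with hu
  have hcont : ContinuousOn (fun x => h (p + x)) B :=
    hd.continuousOn.comp (by fun_prop) fun x hx => by simpa [hB] using hx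
  have hum : Measurable u := by
    have : Measurable (B.indicator fun x => h (p + x)) := by
      classical
      rw [← Set.piecewise_eq_indicator]
      exact hcont.measurable_piecewise continuousOn_const measurableSet_ball
    have e : u = fun x => ‖B.indicator (fun x => h (p + x)) x‖ₑ ^ 2 := by
      funext x
      by_cases hx : x ∈ B <;> simp [hu, hx]
    rw [e]
    exact this.enorm.pow_const 2
  have hcirc : ∀ θ : ℝ, ‖circleMap 0 1 θ‖ = 1 := fun θ => by simp
  have hpt : ∀ x ∈ B, ‖h p‖ₑ ^ 2 ≤ ENNReal.ofReal (2 * Real.pi)⁻¹ *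
      ∫⁻ θ in Set.Ioc 0 (2 * Real.pi), u (circleMap 0 1 θ • x) := fun x hx => by
    have hx' : ‖x‖ < r := by simpa [hB] using hx
    have hmaps : ∀ z ∈ Metric.closedBall (0 : ℂ) 1, z • x ∈ B := fun z hz => by
      have hz' : ‖z‖ ≤ 1 := by simpa using hz
      rw [hB, mem_ball_zero_iff, norm_smul]
      nlinarith [norm_nonneg x]
    have hdc : DiffContOnCl ℂ (fun z : ℂ => h (p + z • x) ^ 2) (Metric.ball 0 |1|) := by
      rw [abs_one]
      have h1 : ContinuousOn (fun z : ℂ => h (p + z • x)) (Metric.closedBall 0 1) :=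
        hcont.comp (f := fun z : ℂ => z • x) (by fun_prop) hmaps
      have h2 : DifferentiableOn ℂ (fun z : ℂ => h (p + z • x)) (Metric.ball 0 1) :=
        hd.comp (f := fun z : ℂ => p + z • x) (by fun_prop) fun z hz => by
          simpa [hB] using hmaps z (Metric.ball_subset_closedBall hz)
      refine ⟨h2.pow 2, ?_⟩
      rw [closure_ball _ one_ne_zero]
      exact h1.pow 2
    have hav := hdc.circleAverage
    rw [Real.circleAverage_def, intervalIntegral.integral_of_le (by positivity)] at hav
    simp only [zero_smul, add_zero] at hav
    rw [← enorm_pow, ← hav, enorm_smul]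
    have e1 : ‖(2 * Real.pi)⁻¹‖ₑ = ENNReal.ofReal (2 * Real.pi)⁻¹ :=
      Real.enorm_of_nonneg (by positivity)
    rw [e1]
    gcongr
    refine (enorm_integral_le_lintegral_enorm _).trans_eq (lintegral_congr fun θ => ?_)
    rw [hu, Set.indicator_of_mem (hmaps _ (by simp)), enorm_pow]
  have hrot : ∀ θ : ℝ, ∫⁻ x, u (circleMap 0 1 θ • x) = ∫⁻ x, u x := fun θ => by
    let L : Cn n ≃ₗᵢ[ℝ] Cn n :=
      { toLinearEquiv := (LinearEquiv.smulOfNeZero ℂ (Cn n) (circleMap 0 1 θ)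
          (norm_ne_zero_iff.1 (by rw [hcirc]; exact one_ne_zero))).restrictScalars ℝ
        norm_map' := fun x => by
          change ‖circleMap 0 1 θ • x‖ = ‖x‖
          rw [norm_smul, hcirc, one_mul] }
    exact L.measurePreserving.lintegral_comp hum
  have hshift : ∫⁻ x in Metric.ball p r, ‖h x‖ₑ ^ 2 = ∫⁻ x, u x := by
    rw [hu, lintegral_indicator measurableSet_ball, ← lintegral_indicator measurableSet_ball,
      ← lintegral_indicator measurableSet_ball, ← lintegral_add_left_eq_self _ p]
    refine lintegral_congr fun x => ?_
    simp [Set.indicator]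
  have hvol : volume (Metric.ball p r) = volume B := by
    rw [hB, Measure.addHaar_ball_center]
  rw [hshift, hvol, ← setLIntegral_const]
  calc ∫⁻ _x in B, ‖h p‖ₑ ^ 2 ≤ ∫⁻ x in B, ENNReal.ofReal (2 * Real.pi)⁻¹ *
          ∫⁻ θ in Set.Ioc 0 (2 * Real.pi), u (circleMap 0 1 θ • x) :=
        setLIntegral_mono' measurableSet_ball hpt
    _ ≤ ∫⁻ x, ENNReal.ofReal (2 * Real.pi)⁻¹ *
          ∫⁻ θ in Set.Ioc 0 (2 * Real.pi), u (circleMap 0 1 θ • x) := setLIntegral_le_lintegral _ _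
    _ = ENNReal.ofReal (2 * Real.pi)⁻¹ *
          ∫⁻ θ in Set.Ioc 0 (2 * Real.pi), ∫⁻ x, u (circleMap 0 1 θ • x) := by
        have hjoint : Measurable fun q : Cn n × ℝ => u (circleMap 0 1 q.2 • q.1) :=
          hum.comp (((continuous_circleMap 0 1).comp continuous_snd).smul continuous_fst).measurable
        rw [lintegral_const_mul' _ _ ENNReal.ofReal_ne_top,
          lintegral_lintegral_swap hjoint.aemeasurable]
    _ = ∫⁻ x, u x := by
        simp only [hrot]
        rw [setLIntegral_const, Real.volume_Ioc, sub_zero, mul_comm, mul_assoc,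
          ← ENNReal.ofReal_mul (by positivity), mul_inv_cancel₀ (by positivity), ENNReal.ofReal_one,
          mul_one]

/-! ### Propagation along chains of balls in a connected set. -/

/-- While some index has not been reached, the reached and unreached families form two open sets
that cover `W` and both meet it, so they intersect. Hence at least one new index is gained at each
step. -/
theorem IsPreconnected.forall_of_chain_step {V ι : Type*} [TopologicalSpace V] {W : Set V}
    (hW : IsPreconnected W) (T : Finset ι) (U : ι → Set V) (hU : ∀ i ∈ T, IsOpen (U i))
    (hcov : W ⊆ ⋃ i ∈ T, U i) (hmeet : ∀ i ∈ T, (W ∩ U i).Nonempty) (P : ℕ → ι → Prop)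
    (hstep : ∀ k, ∀ i ∈ T, ∀ j ∈ T, P k i → (U i ∩ U j).Nonempty → P (k + 1) j)
    {i₀ : ι} (hi₀ : i₀ ∈ T) (hP : P 0 i₀) : ∀ i ∈ T, P T.card i := by
  classical
  have hmono : ∀ k, ∀ i ∈ T, P k i → P (k + 1) i := fun k i hi h =>
    hstep k i hi i hi h (by rw [Set.inter_self]; exact (hmeet i hi).mono Set.inter_subset_right)
  have hgrow : ∀ k, i₀ ∈ T.filter (P k) ∧
      (k + 1 ≤ (T.filter (P k)).card ∨ ∀ i ∈ T, P k i) := fun k => by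
    induction k with
    | zero =>
      have h0 : i₀ ∈ T.filter (P 0) := Finset.mem_filter.2 ⟨hi₀, hP⟩
      exact ⟨h0, Or.inl (Finset.card_pos.2 ⟨i₀, h0⟩)⟩
    | succ k ih =>
      obtain ⟨h0, hk⟩ := ih
      have h0' : i₀ ∈ T.filter (P (k + 1)) :=
        Finset.mem_filter.2 ⟨hi₀, hmono k i₀ hi₀ (Finset.mem_filter.1 h0).2⟩
      refine ⟨h0', ?_⟩
      by_cases hall : ∀ i ∈ T, P k i
      · exact Or.inr fun i hi => hmono k i hi (hall i hi)
      left
      replace hk := hk.resolve_right hall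
      push Not at hall
      obtain ⟨j₀, hj₀, hPj₀⟩ := hall
      obtain ⟨x, -, hx1, hx2⟩ := hW (⋃ i ∈ T.filter (P k), U i)
        (⋃ i ∈ T.filter (fun i => ¬ P k i), U i)
        (isOpen_biUnion fun i hi => hU i (Finset.mem_filter.1 hi).1)
        (isOpen_biUnion fun i hi => hU i (Finset.mem_filter.1 hi).1)
        (fun x hx => by
          obtain ⟨i, hi, hxi⟩ := Set.mem_iUnion₂.1 (hcov hx)
          by_cases h : P k i
          · exact Or.inl (Set.mem_iUnion₂.2 ⟨i, Finset.mem_filter.2 ⟨hi, h⟩, hxi⟩)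
          · exact Or.inr (Set.mem_iUnion₂.2 ⟨i, Finset.mem_filter.2 ⟨hi, h⟩, hxi⟩))
        ((hmeet i₀ hi₀).mono (Set.inter_subset_inter_right _
          (Set.subset_biUnion_of_mem (u := U) h0)))
        ((hmeet j₀ hj₀).mono (Set.inter_subset_inter_right _
          (Set.subset_biUnion_of_mem (u := U) (Finset.mem_filter.2 ⟨hj₀, hPj₀⟩))))
      obtain ⟨i, hi, hxi⟩ := Set.mem_iUnion₂.1 hx1
      obtain ⟨j, hj, hxj⟩ := Set.mem_iUnion₂.1 hx2
      obtain ⟨hiT, hPi⟩ := Finset.mem_filter.1 hi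
      obtain ⟨hjT, hPj⟩ := Finset.mem_filter.1 hj
      have hsub : insert j (T.filter (P k)) ⊆ T.filter (P (k + 1)) := by
        intro i' hi'
        rcases Finset.mem_insert.1 hi' with rfl | hi'
        · exact Finset.mem_filter.2 ⟨hjT, hstep k i hiT i' hjT hPi ⟨x, hxi, hxj⟩⟩
        · obtain ⟨h1, h2⟩ := Finset.mem_filter.1 hi'
          exact Finset.mem_filter.2 ⟨h1, hmono k i' h1 h2⟩
      have hcard := Finset.card_le_card hsub
      rw [Finset.card_insert_of_notMem (fun h => hPj (Finset.mem_filter.1 h).2)] at hcard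
      omega
  rcases (hgrow T.card).2 with h | h
  · have := Finset.card_filter_le T (P T.card)
    omega
  · exact h

set_option maxHeartbeats 1000000 in
/-- Remez inequality on a connected set of bounded size, uniform in the shape of the set. -/
theorem exists_remez_const_of_isPreconnected (n : ℕ) (hn : 1 ≤ n) (d : ℝ) (hd : 0 < d) :
    ∃ K : ℝ, 0 < K ∧ ∀ (W S : Set (Cn n)) (c y : Cn n) (h : Cn n → ℂ) (M η a s : ℝ),
      IsPreconnected W → W ⊆ Metric.closedBall c (1 / 2) →
      DifferentiableOn ℂ h (Metric.thickening d W) → (∀ x ∈ Metric.thickening d W, ‖h x‖ ≤ M) →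
      y ∈ W → Real.exp (-a) * M ≤ ‖h y‖ → MeasurableSet S → S ⊆ W → (∀ x ∈ S, ‖h x‖ ≤ η) →
      0 ≤ η → 0 ≤ a → 0 < s → s ≤ 1 → ENNReal.ofReal s ≤ volume S →
      M ≤ η * Real.exp (K * (a + 1) * (1 + Real.log (1 / s))) := by
  classical
  -- A point of a covering ball is within `2 * r` of `W`, and the local inequality at scale `4 * r`
  -- needs a ball of radius `20 * r`: in total `22 * r = d`.
  set r := d / 22 with hr
  have hrpos : 0 < r := by positivity
  obtain ⟨K₁, hK₁, hrem⟩ := exists_remez_const n hn (4 * r) (by positivity)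
  obtain ⟨T', -, hT'fin, hT'cov⟩ :=
    (isCompact_closedBall (0 : Cn n) (1 / 2)).finite_cover_balls hrpos
  set T₀ := hT'fin.toFinset with hT₀
  set s₀ := min 1 (volume (Metric.ball (0 : Cn n) r)).toReal with hs₀
  have hs₀pos : 0 < s₀ := lt_min one_pos
    (ENNReal.toReal_pos (Metric.measure_ball_pos _ _ hrpos).ne' measure_ball_lt_top.ne)
  have hs₀1 : s₀ ≤ 1 := min_le_left _ _
  have hL₀ : 0 ≤ Real.log (1 / s₀) := Real.log_nonneg ((one_le_div hs₀pos).2 hs₀1)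
  -- For `b ≥ 1` this gives `K₁ * (b + 1) * (1 + log (1 / s₀)) < q * b`, so exponent `b` on one ball
  -- becomes at most `q * b` on a neighbour.
  set q := 2 * K₁ * (1 + Real.log (1 / s₀)) + 2 with hq
  have hq1 : 1 ≤ q := by
    have : 0 ≤ 2 * K₁ * (1 + Real.log (1 / s₀)) := by positivity
    linarith
  -- Pigeonhole constant; the `+ 1` makes `T.card * (s / κ) < s` strict.
  set κ : ℝ := T₀.card + 1 with hκ
  have hκ1 : 1 ≤ κ := by rw [hκ]; linarith [(Nat.cast_nonneg T₀.card : (0 : ℝ) ≤ _)]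
  have hlκ : 0 ≤ Real.log κ := Real.log_nonneg hκ1
  refine ⟨2 * K₁ * q ^ T₀.card * (1 + Real.log κ), by positivity, ?_⟩
  intro W S c y h M η a s hW hWc hhd hhM hy hyM hS hSW hSη hη ha hs hs1 hSs
  have hM : 0 ≤ M := (norm_nonneg _).trans (hhM y (Metric.self_subset_thickening hd W hy))
  rcases hM.eq_or_lt with hM0 | hMpos
  · rw [← hM0]; positivity
  have hls : 0 ≤ Real.log (1 / s) := Real.log_nonneg ((one_le_div hs).2 hs1)
  -- Translating one fixed cover keeps the number of balls independent of `W` and `c`.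
  set U : Cn n → Set (Cn n) := fun t => Metric.ball (c + t) r with hU
  set T := T₀.filter fun t => (W ∩ U t).Nonempty with hT
  have hTcard : T.card ≤ T₀.card := Finset.card_filter_le _ _
  have hcov : W ⊆ ⋃ t ∈ T, U t := fun x hx => by
    have h1 : x - c ∈ Metric.closedBall (0 : Cn n) (1 / 2) := by
      rw [mem_closedBall_zero_iff, ← mem_closedBall_iff_norm]; exact hWc hx
    obtain ⟨t, ht, hxt⟩ := Set.mem_iUnion₂.1 (hT'cov h1)
    have h2 : x ∈ U t := by
      rw [hU, mem_ball_iff_norm]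
      rw [mem_ball_iff_norm] at hxt
      rwa [sub_add_eq_sub_sub]
    exact Set.mem_iUnion₂.2 ⟨t, Finset.mem_filter.2 ⟨by simpa [hT₀] using ht, x, hx, h2⟩, h2⟩
  have hmeet : ∀ t ∈ T, (W ∩ U t).Nonempty := fun t ht => (Finset.mem_filter.1 ht).2
  have hthick : ∀ t ∈ T, ∀ p ∈ U t, Metric.ball p (5 * (4 * r)) ⊆ Metric.thickening d W := by
    intro t ht p hp x hx
    obtain ⟨w, hwW, hw⟩ := hmeet t ht
    rw [Metric.mem_thickening_iff]
    refine ⟨w, hwW, ?_⟩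
    rw [hU] at hp hw
    rw [Metric.mem_ball] at hp hw hx
    have h1 := dist_triangle x p w
    have h2 := dist_triangle_right p w (c + t)
    linarith
  have hbig : ∀ t ∈ T, ∃ p ∈ U t, Real.exp (-(q ^ T.card * (a + 1))) * M ≤ ‖h p‖ := by
    obtain ⟨i₀, hi₀, hyi₀⟩ := Set.mem_iUnion₂.1 (hcov hy)
    refine hW.forall_of_chain_step T U (fun _ _ => Metric.isOpen_ball) hcov hmeet
      (fun k t => ∃ p ∈ U t, Real.exp (-(q ^ k * (a + 1))) * M ≤ ‖h p‖) ?_ hi₀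
      ⟨y, hyi₀, le_trans ?_ hyM⟩
    · rintro k i hi j hj ⟨p, hp, hpM⟩ ⟨x, hxi, hxj⟩
      -- If `h` were below `e^{-qb} M` on all of `U j`, the local Remez inequality centred at `p`
      -- would give `M < M`.
      by_contra! hcon
      set b := q ^ k * (a + 1) with hb
      have hb1 : 1 ≤ b := by
        have := one_le_pow₀ (n := k) hq1
        nlinarith
      have hb' : q ^ (k + 1) * (a + 1) = q * b := by rw [hb]; ring
      rw [hb'] at hcon
      have h1 := hrem h p (U j) M (Real.exp (-(q * b)) * M) b s₀ hM (by positivity) (by linarith)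
        hs₀pos hs₀1 (hhd.mono (hthick i hi p hp)) (fun z hz => hhM z (hthick i hi p hp hz)) hpM
        measurableSet_ball (fun z hz => by
          rw [hU] at hp hxi hxj hz
          rw [Metric.mem_ball] at hp hxi hxj hz ⊢
          have h1 := dist_triangle z x p
          have h2 := dist_triangle_right z x (c + j)
          have h3 := dist_triangle_right x p (c + i)
          linarith)
        (by
          rw [hU, Measure.addHaar_ball_center, ENNReal.ofReal_le_iff_le_toReal
            measure_ball_lt_top.ne]
          exact min_le_right _ _) (fun z hz => (hcon z hz).le)
      have h2 : Real.exp (-(q * b)) * M * Real.exp (K₁ * (b + 1) * (1 + Real.log (1 / s₀))) =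
          Real.exp (-(q * b) + K₁ * (b + 1) * (1 + Real.log (1 / s₀))) * M := by
        rw [Real.exp_add]; ring
      rw [h2] at h1
      have h3 : -(q * b) + K₁ * (b + 1) * (1 + Real.log (1 / s₀)) < 0 := by
        have h4 : 0 ≤ K₁ * (1 + Real.log (1 / s₀)) := by positivity
        rw [hq]
        nlinarith
      have h5 := (Real.exp_lt_exp.2 h3).trans_eq Real.exp_zero
      nlinarith
    · rw [pow_zero, one_mul]
      gcongr
      linarith
  obtain ⟨t, ht, htS⟩ : ∃ t ∈ T, ENNReal.ofReal (s / κ) ≤ volume (S ∩ U t) := by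
    by_contra! hcon
    have h1 : volume S ≤ ∑ t ∈ T, volume (S ∩ U t) := by
      refine (measure_mono fun x hx => ?_).trans (measure_biUnion_finset_le T fun t => S ∩ U t)
      obtain ⟨t, ht, hxt⟩ := Set.mem_iUnion₂.1 (hcov (hSW hx))
      exact Set.mem_iUnion₂.2 ⟨t, ht, hx, hxt⟩
    have h2 : ENNReal.ofReal s ≤ ENNReal.ofReal (T.card * (s / κ)) := by
      refine (hSs.trans h1).trans ((Finset.sum_le_sum fun t ht => (hcon t ht).le).trans_eq ?_)
      rw [Finset.sum_const, nsmul_eq_mul, ENNReal.ofReal_mul (by positivity),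
        ENNReal.ofReal_natCast]
    rw [ENNReal.ofReal_le_ofReal_iff (by positivity), mul_div_assoc', le_div_iff₀ (by positivity)]
      at h2
    have h3 : (T.card : ℝ) ≤ T₀.card := by exact_mod_cast hTcard
    rw [hκ] at h2
    nlinarith
  obtain ⟨p, hp, hpM⟩ := hbig t ht
  have hfin := hrem h p (S ∩ U t) M η (q ^ T.card * (a + 1)) (s / κ) hM hη (by positivity)
    (by positivity) ((div_le_one (by positivity)).2 (hs1.trans hκ1)) (hhd.mono (hthick t ht p hp))
    (fun z hz => hhM z (hthick t ht p hp hz)) hpM (hS.inter measurableSet_ball)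
    (fun z hz => by
      have hz' := hz.2
      rw [hU] at hp hz'
      rw [Metric.mem_ball] at hp hz' ⊢
      have h1 := dist_triangle_right z p (c + t)
      linarith) htS (fun z hz => hSη z hz.1)
  refine hfin.trans (mul_le_mul_of_nonneg_left (Real.exp_le_exp.2 ?_) hη)
  have e1 : Real.log (1 / (s / κ)) = Real.log κ + Real.log (1 / s) := by
    rw [← Real.log_mul (by positivity) (by positivity)]
    congr 1
    field_simp
  rw [e1]
  have h1 : q ^ T.card * (a + 1) + 1 ≤ 2 * (q ^ T₀.card * (a + 1)) := by
    have h2 : q ^ T.card ≤ q ^ T₀.card := pow_le_pow_right₀ hq1 hTcard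
    have h3 := one_le_pow₀ (n := T₀.card) hq1
    nlinarith
  have h2 : 1 + (Real.log κ + Real.log (1 / s)) ≤ (1 + Real.log κ) * (1 + Real.log (1 / s)) := by
    nlinarith
  calc K₁ * (q ^ T.card * (a + 1) + 1) * (1 + (Real.log κ + Real.log (1 / s)))
      ≤ K₁ * (2 * (q ^ T₀.card * (a + 1))) * ((1 + Real.log κ) * (1 + Real.log (1 / s))) := by
        gcongr
    _ = _ := by ring

/-! ### Passage between `L²` averages and pointwise bounds. -/

/-- A ball is connected, so one that misses the frontier stays in the interior as soon as its centre
is there. -/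
theorem ball_subset_interior_of_le_dist_frontier {V : Type*} [NormedAddCommGroup V]
    [NormedSpace ℝ V] {A : Set V} {z : V} {δ : ℝ} (hδ : 0 < δ) (hz : z ∈ A)
    (h : ∀ p ∈ frontier A, δ ≤ dist z p) : Metric.ball z δ ⊆ interior A := by
  have hfr : ∀ x ∈ Metric.ball z δ, x ∉ frontier A := fun x hx hxA => by
    have := h x hxA
    rw [Metric.mem_ball, dist_comm] at hx
    linarith
  have hzint : z ∈ interior A := by
    by_contra hn
    exact hfr z (Metric.mem_ball_self hδ) ⟨subset_closure hz, hn⟩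
  refine (convex_ball z δ).isPreconnected.subset_of_closure_inter_subset isOpen_interior
    ⟨z, Metric.mem_ball_self hδ, hzint⟩ ?_
  rintro x ⟨hxc, hxb⟩
  by_contra hn
  exact hfr x hxb ⟨closure_mono interior_subset hxc, hn⟩

theorem l2Norm_nonneg {n : ℕ} (f : Cn n → ℂ) (F : Set (Cn n)) : 0 ≤ l2Norm f F :=
  ENNReal.toReal_nonneg

theorem l2Avg_nonneg {n : ℕ} (f : Cn n → ℂ) (F : Set (Cn n)) : 0 ≤ l2Avg f F :=
  div_nonneg (l2Norm_nonneg f F) (by positivity)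

theorem l2Norm_mono {n : ℕ} {f : Cn n → ℂ} {F G : Set (Cn n)} (hFG : F ⊆ G)
    (hG : MemLp f 2 (volume.restrict G)) : l2Norm f F ≤ l2Norm f G :=
  ENNReal.toReal_mono hG.2.ne (eLpNorm_mono_measure f (Measure.restrict_mono hFG le_rfl))

theorem l2Avg_le_of_forall_norm_le {n : ℕ} {f : Cn n → ℂ} {F : Set (Cn n)} (hF : MeasurableSet F)
    (h0 : volume F ≠ 0) (htop : volume F ≠ ⊤) {b : ℝ} (hb : 0 ≤ b) (h : ∀ x ∈ F, ‖f x‖ ≤ b) :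
    l2Avg f F ≤ b := by
  have hpos : 0 < (volume F).toReal := ENNReal.toReal_pos h0 htop
  have h1 : eLpNorm f 2 (volume.restrict F) ≤ volume F ^ ((1 : ℝ) / 2) * ENNReal.ofReal b := by
    have := eLpNorm_le_of_ae_bound (p := 2) (μ := volume.restrict F) (f := f) (C := b)
      ((ae_restrict_iff' hF).2 (Filter.Eventually.of_forall h))
    simpa using this
  rw [l2Avg, div_le_iff₀ (by positivity), l2Norm, mul_comm]
  refine (ENNReal.toReal_mono (ENNReal.mul_ne_top (ENNReal.rpow_ne_top_of_nonneg (by norm_num) htop)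
    ENNReal.ofReal_ne_top) h1).trans_eq ?_
  rw [ENNReal.toReal_mul, ENNReal.toReal_ofReal hb, ENNReal.toReal_rpow]

theorem sq_l2Norm {n : ℕ} {f : Cn n → ℂ} {F : Set (Cn n)} (hF : MemLp f 2 (volume.restrict F)) :
    ENNReal.ofReal (l2Norm f F ^ 2) = ∫⁻ x in F, ‖f x‖ₑ ^ 2 := by
  rw [ENNReal.ofReal_pow (l2Norm_nonneg f F), l2Norm, ENNReal.ofReal_toReal hF.2.ne]
  have := eLpNorm_nnreal_pow_eq_lintegral (f := f) (μ := volume.restrict F) (p := 2) two_ne_zero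
  simpa using this

theorem norm_le_of_ball_subset {n : ℕ} {f : Cn n → ℂ} {A : Set (Cn n)} {p : Cn n} {r : ℝ}
    (hr : 0 < r) (hf : MemLp f 2 (volume.restrict A)) (hd : DifferentiableOn ℂ f (interior A))
    (hp : Metric.ball p r ⊆ interior A) :
    ‖f p‖ ≤ l2Norm f A / (volume (Metric.ball (0 : Cn n) r)).toReal ^ ((1 : ℝ) / 2) := by
  set V := (volume (Metric.ball (0 : Cn n) r)).toReal with hV
  have hVpos : 0 < V :=
    ENNReal.toReal_pos (Metric.measure_ball_pos _ _ hr).ne' measure_ball_lt_top.ne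
  have h1 : ‖f p‖ ^ 2 * V ≤ l2Norm f A ^ 2 := by
    rw [← ENNReal.ofReal_le_ofReal_iff (by positivity), sq_l2Norm hf,
      ENNReal.ofReal_mul (by positivity), hV, ENNReal.ofReal_toReal measure_ball_lt_top.ne,
      ← Measure.addHaar_ball_center _ p, ENNReal.ofReal_pow (norm_nonneg _), ofReal_norm]
    exact (enorm_sq_mul_volume_ball_le (hd.mono hp)).trans
      (lintegral_mono_set (hp.trans interior_subset))
  rw [le_div_iff₀ (by positivity), ← Real.sqrt_eq_rpow]
  refine abs_le_of_sq_le_sq' ?_ (l2Norm_nonneg f A) |>.2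
  rwa [mul_pow, Real.sq_sqrt hVpos.le]

/-- Chebyshev at level `2 * η`: the exceptional set has at most a quarter of the volume. -/
theorem half_volume_le_of_l2Avg_lt {n : ℕ} {f : Cn n → ℂ} {E : Set (Cn n)}
    (h0 : volume E ≠ 0) (htop : volume E ≠ ⊤) (hf : MemLp f 2 (volume.restrict E))
    {η : ℝ} (hη : l2Avg f E < η) :
    (volume E).toReal / 2 ≤ (volume (E \ {x | 2 * η ≤ ‖f x‖})).toReal := by
  have hη0 : 0 < η := (l2Avg_nonneg f E).trans_lt hη
  set v := (volume E).toReal with hv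
  have hvpos : 0 < v := ENNReal.toReal_pos h0 htop
  have hnorm : l2Norm f E ^ 2 ≤ η ^ 2 * v := by
    rw [l2Avg, div_lt_iff₀ (by positivity), ← Real.sqrt_eq_rpow] at hη
    calc l2Norm f E ^ 2 ≤ (η * √v) ^ 2 := pow_le_pow_left₀ (l2Norm_nonneg f E) hη.le 2
      _ = _ := by rw [mul_pow, Real.sq_sqrt hvpos.le]
  have hcheb := meas_ge_le_mul_pow_eLpNorm_enorm (volume.restrict E) (p := 2) two_ne_zero
    ENNReal.ofNat_ne_top hf.1 (ε := ENNReal.ofReal (2 * η))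
    (by simpa using hη0) (fun h => absurd h ENNReal.ofReal_ne_top)
  have hbad : volume (E ∩ {x | 2 * η ≤ ‖f x‖}) ≤ ENNReal.ofReal (v / 4) := by
    have h1 : volume (E ∩ {x | 2 * η ≤ ‖f x‖}) ≤
        volume.restrict E {x | ENNReal.ofReal (2 * η) ≤ ‖f x‖ₑ} := by
      refine le_trans (le_of_eq ?_) (Measure.le_restrict_apply _ _)
      congr 1
      ext x
      rw [Set.mem_inter_iff, Set.mem_inter_iff, Set.mem_ofPred_eq, Set.mem_ofPred_eq, ← ofReal_norm,
        ENNReal.ofReal_le_ofReal_iff (norm_nonneg _), and_comm]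
    refine (h1.trans hcheb).trans ?_
    rw [← ENNReal.ofReal_toReal hf.2.ne, ← l2Norm, ENNReal.toReal_ofNat, ENNReal.rpow_ofNat,
      ENNReal.rpow_ofNat, ← ENNReal.ofReal_inv_of_pos (by positivity),
      ← ENNReal.ofReal_pow (by positivity), ← ENNReal.ofReal_pow (l2Norm_nonneg f E),
      ← ENNReal.ofReal_mul (by positivity)]
    refine ENNReal.ofReal_le_ofReal ?_
    calc (2 * η)⁻¹ ^ 2 * l2Norm f E ^ 2 ≤ (2 * η)⁻¹ ^ 2 * (η ^ 2 * v) := by gcongr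
      _ = v / 4 := by field_simp; norm_num
  have hsum : volume E ≤ ENNReal.ofReal (v / 4) + volume (E \ {x | 2 * η ≤ ‖f x‖}) :=
    (measure_le_inter_add_sdiff _ _ _).trans (by gcongr)
  have hfin : volume (E \ {x | 2 * η ≤ ‖f x‖}) ≠ ⊤ :=
    ((measure_mono Set.sdiff_subset).trans_lt htop.lt_top).ne
  have := ENNReal.toReal_mono (ENNReal.add_ne_top.2 ⟨ENNReal.ofReal_ne_top, hfin⟩) hsum
  rw [ENNReal.toReal_add ENNReal.ofReal_ne_top hfin, ENNReal.toReal_ofReal (by positivity)] at this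
  linarith

set_option maxHeartbeats 1000000 in
/-- The normalized `L²` Remez inequality, with the logarithmic dependence on the density that is
available in every dimension. -/
theorem exists_l2Avg_remez_const (n : ℕ) (hn : 1 ≤ n) (d ℓ : ℝ) (hd : 0 < d) (hℓ : 0 < ℓ) :
    ∃ C : ℝ, 0 < C ∧ ∀ (A B E : Set (Cn n)), MeasurableSet B → MeasurableSet E →
      B ⊆ A → E ⊆ B → 0 < volume E → Metric.diam B = 1 / 4 → ENNReal.ofReal ℓ ≤ volume B →
      LiesInOneComponent d A B → ∀ h : Cn n → ℂ, MemBergman2 A h →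
        l2Avg h B ≤ C * Real.exp (C * (doublingIndex h A B + 1) *
          (1 + Real.log (1 / density E B))) * l2Avg h E := by
  obtain ⟨K, hK, hrem⟩ := exists_remez_const_of_isPreconnected n hn (d / 4) (by positivity)
  set V := (volume (Metric.ball (0 : Cn n) (d / 4))).toReal with hV
  have hVpos : 0 < V := ENNReal.toReal_pos (Metric.measure_ball_pos _ _ (by positivity)).ne'
    measure_ball_lt_top.ne
  set V₁ := (volume (Metric.closedBall (0 : Cn n) (1 / 4))).toReal with hV₁
  have hV₁pos : 0 < V₁ := ENNReal.toReal_pos (Metric.measure_closedBall_pos _ _ (by positivity)).ne'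
    measure_closedBall_lt_top.ne
  -- Some point of `B` has `‖h y‖` at least half the average over `B`; as `|B| ≤ V₁`, this is at
  -- least `e^{-N} * w * M`. Thus the exponent `a` becomes `N + c₀`.
  set w := V ^ ((1 : ℝ) / 2) / V₁ ^ ((1 : ℝ) / 2) / 2 with hw
  have hwpos : 0 < w := by positivity
  set c₀ := |Real.log w| with hc₀
  have hc₀0 : 0 ≤ c₀ := abs_nonneg _
  have hc₀w : Real.exp (-c₀) ≤ w := by
    rw [← Real.le_log_iff_exp_le hwpos]; exact neg_abs_le _
  -- The good half of `E` has volume at least `δ * |B| / 2 ≥ δ * m`.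
  set m := min 1 (ℓ / 2) with hm
  have hmpos : 0 < m := by positivity
  have hm1 : m ≤ 1 := min_le_left _ _
  have hlm : 0 ≤ Real.log (1 / m) := Real.log_nonneg ((one_le_div hmpos).2 hm1)
  set C := 2 + K * (1 + c₀) * (1 + Real.log (1 / m)) with hC
  have hCpos : 0 < C := by positivity
  refine ⟨C, hCpos, ?_⟩
  rintro A B E hBm hEm hBA hEB hE hdiam hBℓ ⟨c, W, hW, hBW, hWin⟩ h ⟨hhol, hmem⟩
  have hball : ∀ z ∈ W, Metric.ball z (d / 2) ⊆ interior A := fun z hz =>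
    ball_subset_interior_of_le_dist_frontier (by positivity) (hWin hz).1 (hWin hz).2.2
  have hWint : W ⊆ interior A := fun z hz => hball z hz (Metric.mem_ball_self (by positivity))
  have hWc : W ⊆ Metric.closedBall c (1 / 2) := fun z hz => (hWin hz).2.1
  -- The margin `d / 2` is split: half for thickening `W`, half for the mean-value balls that give
  -- the sup bound `M`.
  have hthick : ∀ p ∈ Metric.thickening (d / 4) W, Metric.ball p (d / 4) ⊆ interior A := by
    intro p hp
    obtain ⟨z, hz, hpz⟩ := Metric.mem_thickening_iff.1 hp
    exact (Metric.ball_subset_ball' (by linarith)).trans (hball z hz)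
  have hthick' : Metric.thickening (d / 4) W ⊆ interior A := fun p hp =>
    hthick p hp (Metric.mem_ball_self (by positivity))
  have hBtop : volume B ≠ ⊤ :=
    ((measure_mono (hBW.trans hWc)).trans_lt measure_closedBall_lt_top).ne
  have hB0 : volume B ≠ 0 := (hE.trans_le (measure_mono hEB)).ne'
  have hEtop : volume E ≠ ⊤ := ((measure_mono hEB).trans_lt hBtop.lt_top).ne
  set vB := (volume B).toReal with hvB
  set vE := (volume E).toReal with hvE
  have hvBpos : 0 < vB := ENNReal.toReal_pos hB0 hBtop
  have hvEpos : 0 < vE := ENNReal.toReal_pos hE.ne' hEtop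
  have hvBℓ : ℓ ≤ vB := (ENNReal.ofReal_le_iff_le_toReal hBtop).1 hBℓ
  have hvBV₁ : vB ≤ V₁ := by
    obtain ⟨y, hy⟩ := nonempty_of_measure_ne_zero hB0
    have hbdd : Bornology.IsBounded B := Metric.isBounded_closedBall.subset (hBW.trans hWc)
    refine ENNReal.toReal_mono measure_closedBall_lt_top.ne ?_
    rw [← Measure.addHaar_closedBall_center _ y]
    exact measure_mono fun x hx => Metric.mem_closedBall.2
      ((Metric.dist_le_diam_of_mem hbdd hx hy).trans_eq hdiam)
  set δ := density E B with hδ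
  have hδe : δ = vE / vB := rfl
  have hδpos : 0 < δ := by rw [hδe]; positivity
  have hδ1 : δ ≤ 1 := by
    rw [hδe, div_le_one hvBpos]; exact ENNReal.toReal_mono hBtop (measure_mono hEB)
  have hlδ : 0 ≤ Real.log (1 / δ) := Real.log_nonneg ((one_le_div hδpos).2 hδ1)
  rcases (l2Norm_nonneg h B).eq_or_lt with hzero | hpos
  · have : l2Avg h B = 0 := by rw [l2Avg, ← hzero, zero_div]
    rw [this]
    exact mul_nonneg (by positivity) (l2Avg_nonneg h E)
  have hAB := l2Norm_mono hBA hmem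
  have hApos : 0 < l2Norm h A := hpos.trans_le hAB
  set N := doublingIndex h A B with hN
  have hN0 : 0 ≤ N := Real.log_nonneg ((one_le_div hpos).2 hAB)
  have hexpN : l2Norm h B = Real.exp (-N) * l2Norm h A := by
    rw [hN, doublingIndex, Real.exp_neg, Real.exp_log (by positivity)]
    field_simp
  set M := l2Norm h A / V ^ ((1 : ℝ) / 2) with hM
  have hMpos : 0 < M := by positivity
  have hhM : ∀ x ∈ Metric.thickening (d / 4) W, ‖h x‖ ≤ M := fun x hx =>
    norm_le_of_ball_subset (by positivity) hmem hhol (hthick x hx)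
  have hBM : l2Avg h B ≤ M := l2Avg_le_of_forall_norm_le hBm hB0 hBtop hMpos.le fun x hx =>
    hhM x (Metric.self_subset_thickening (by positivity) W (hBW hx))
  have hAvgpos : 0 < l2Avg h B := div_pos hpos (by positivity)
  obtain ⟨y, hyB, hy⟩ : ∃ y ∈ B, l2Avg h B / 2 ≤ ‖h y‖ := by
    by_contra! hcon
    have := l2Avg_le_of_forall_norm_le hBm hB0 hBtop (by positivity) fun x hx => (hcon x hx).le
    linarith
  have hyM : Real.exp (-(N + c₀)) * M ≤ ‖h y‖ := by
    refine le_trans ?_ hy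
    rw [neg_add, Real.exp_add, l2Avg, hexpN]
    calc Real.exp (-N) * Real.exp (-c₀) * M ≤ Real.exp (-N) * w * M := by gcongr
      _ = Real.exp (-N) * l2Norm h A / V₁ ^ ((1 : ℝ) / 2) / 2 := by
          rw [hw, hM]; field_simp
      _ ≤ _ := by
          gcongr
  set s := δ * m with hs
  have hspos : 0 < s := by positivity
  have hs1 : s ≤ 1 := by rw [hs]; nlinarith
  -- A strict majorant `η` is used because the average over `E` is not known to be positive; `η` is
  -- lowered to it at the end.
  have hmain : ∀ η, l2Avg h E < η →
      l2Avg h B / (C * Real.exp (C * (N + 1) * (1 + Real.log (1 / δ)))) ≤ η := by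
    intro η hη
    have hη0 : 0 < η := (l2Avg_nonneg h E).trans_lt hη
    set S := E \ {x | 2 * η ≤ ‖h x‖} with hS
    have hEint : E ⊆ interior A := (hEB.trans hBW).trans hWint
    have hmemE : MemLp h 2 (volume.restrict E) :=
      hmem.mono_measure (Measure.restrict_mono (hEB.trans hBA) le_rfl)
    have hSm : MeasurableSet S := by
      classical
      have hmeas : Measurable ((interior A).indicator h) := by
        rw [← Set.piecewise_eq_indicator]
        exact hhol.continuousOn.measurable_piecewise continuousOn_const
          isOpen_interior.measurableSet
      have e : S = E \ {x | 2 * η ≤ ‖(interior A).indicator h x‖} := by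
        ext x
        refine and_congr_right fun hx => ?_
        rw [Set.mem_ofPred_eq, Set.mem_ofPred_eq, Set.indicator_of_mem (hEint hx)]
      rw [e]
      exact hEm.diff (measurableSet_le measurable_const hmeas.norm)
    have hSs : ENNReal.ofReal s ≤ volume S := by
      have hStop : volume S ≠ ⊤ := ((measure_mono Set.sdiff_subset).trans_lt hEtop.lt_top).ne
      rw [ENNReal.ofReal_le_iff_le_toReal hStop]
      refine le_trans ?_ (half_volume_le_of_l2Avg_lt hE.ne' hEtop hmemE hη)
      calc s ≤ δ * (vB / 2) := by
            rw [hs]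
            gcongr
            exact (min_le_right _ _).trans (by linarith)
        _ = vE / 2 := by rw [hδe]; field_simp
    have key := hrem W S c y h M (2 * η) (N + c₀) s hW hWc (hhol.mono hthick') hhM (hBW hyB) hyM
      hSm (Set.sdiff_subset.trans (hEB.trans hBW)) (fun x hx => (not_le.1 hx.2).le)
      (by positivity) (by positivity) hspos hs1 hSs
    rw [div_le_iff₀ (by positivity)]
    refine (hBM.trans key).trans ?_
    have e1 : Real.log (1 / s) = Real.log (1 / δ) + Real.log (1 / m) := by
      rw [hs, ← Real.log_mul (by positivity) (by positivity)]
      congr 1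
      field_simp
    rw [e1, ← mul_assoc, mul_comm 2 η]
    have h1 : N + c₀ + 1 ≤ (1 + c₀) * (N + 1) := by nlinarith
    have h2 : 1 + (Real.log (1 / δ) + Real.log (1 / m)) ≤
        (1 + Real.log (1 / m)) * (1 + Real.log (1 / δ)) := by nlinarith
    have h3 : 2 ≤ C := by rw [hC]; linarith [(by positivity :
      0 ≤ K * (1 + c₀) * (1 + Real.log (1 / m)))]
    have h4 : K * (N + c₀ + 1) * (1 + (Real.log (1 / δ) + Real.log (1 / m))) ≤
        C * (N + 1) * (1 + Real.log (1 / δ)) := by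
      calc _ ≤ K * ((1 + c₀) * (N + 1)) *
            ((1 + Real.log (1 / m)) * (1 + Real.log (1 / δ))) := by gcongr
        _ = (K * (1 + c₀) * (1 + Real.log (1 / m))) * (N + 1) * (1 + Real.log (1 / δ)) := by ring
        _ ≤ _ := by
            gcongr
            rw [hC]
            linarith
    gcongr
  have hfin := le_of_forall_gt_imp_ge_of_dense hmain
  rw [div_le_iff₀ (by positivity)] at hfin
  linarith

/-! ### Affine invariance and conclusion. -/

theorem exists_volume_image_affineEquiv {n : ℕ} (D : Cn n ≃ᵃ[ℂ] Cn n) :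
    ∃ κ : ℝ, 0 < κ ∧ ∀ S : Set (Cn n), volume (D '' S) = ENNReal.ofReal κ * volume S := by
  set L : Cn n ≃ₗ[ℝ] Cn n := D.linear.restrictScalars ℝ with hL
  refine ⟨|LinearMap.det (L : Cn n →ₗ[ℝ] Cn n)|, abs_pos.2 (LinearEquiv.isUnit_det' L).ne_zero,
    fun S => ?_⟩
  rw [← Measure.addHaar_image_linearMap]
  have e : D '' S = (fun x => D 0 + x) '' (L '' S) := by
    rw [Set.image_image]
    refine Set.image_congr fun x _ => ?_
    have h := D.map_vadd 0 x
    simp only [vadd_eq_add, add_zero] at h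
    rw [h, add_comm]
    rfl
  rw [e, Set.image_add_left, measure_preimage_add]
  rfl

theorem l2Norm_comp_symm_image {n : ℕ} {D : Cn n ≃ₜ Cn n} {κ : ℝ} (hκ : 0 < κ)
    (hD : ∀ S : Set (Cn n), volume (D '' S) = ENNReal.ofReal κ * volume S)
    (f : Cn n → ℂ) (S : Set (Cn n)) :
    volume.restrict (D '' S) = ENNReal.ofReal κ • (volume.restrict S).map D ∧
      l2Norm (f ∘ D.symm) (D '' S) = κ ^ ((1 : ℝ) / 2) * l2Norm f S := by
  have hvol : (volume : Measure (Cn n)) = ENNReal.ofReal κ • volume.map D := by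
    ext T hT
    rw [Measure.smul_apply, smul_eq_mul, D.measurableEmbedding.map_apply, ← hD,
      Set.image_preimage_eq _ D.surjective]
  have hres : volume.restrict (D '' S) = ENNReal.ofReal κ • (volume.restrict S).map D := by
    conv_lhs => rw [hvol]
    rw [Measure.restrict_smul, D.measurableEmbedding.restrict_map,
      Set.preimage_image_eq _ D.injective]
  refine ⟨hres, ?_⟩
  rw [l2Norm, l2Norm, hres, eLpNorm_smul_measure_of_ne_top ENNReal.ofNat_ne_top,
    D.measurableEmbedding.eLpNorm_map_measure, Function.comp_assoc, D.symm_comp_self,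
    Function.comp_id, smul_eq_mul, ENNReal.toReal_mul, ← ENNReal.toReal_rpow,
    ENNReal.toReal_ofReal hκ.le]
  simp

theorem one_add_log_inv_density_le_two_mul_sStar {n : ℕ} (hn : 1 ≤ n) {E Y : Set (Cn n)}
    (h0 : 0 < density E Y) (h1 : density E Y ≤ 1) :
    1 + Real.log (1 / density E Y) ≤ 2 * sStar E Y := by
  have hl : 0 ≤ Real.log (1 / density E Y) := Real.log_nonneg ((one_le_div h0).2 h1)
  rw [sStar]
  split_ifs with h
  · linarith
  · have hn2 : (2 : ℝ) ≤ n := by exact_mod_cast (by omega : 2 ≤ n)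
    have hinv : (1 : ℝ) / n ≤ 1 / 2 := by gcongr
    have hε : 1 / 2 ≤ 1 - (1 : ℝ) / n := by linarith
    -- `log x ≤ x ^ ε / ε` with `ε = 1 - 1 / n ≥ 1 / 2`, which is the source of the factor `2`.
    have hlog := Real.log_le_rpow_div (x := 1 / density E Y) (by positivity)
      (by linarith : 0 < 1 - (1 : ℝ) / n)
    have e : (1 / density E Y) ^ (1 - (1 : ℝ) / n) = density E Y ^ ((1 : ℝ) / n - 1) := by
      rw [one_div, Real.inv_rpow h0.le, ← Real.rpow_neg h0.le, neg_sub]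
    rw [e] at hlog
    have h2 : density E Y ^ ((1 : ℝ) / n - 1) / (1 - (1 : ℝ) / n) ≤
        density E Y ^ ((1 : ℝ) / n - 1) / (1 / 2) := by gcongr
    have h3 : density E Y ^ ((1 : ℝ) / n - 1) / (1 / 2) = 2 * density E Y ^ ((1 : ℝ) / n - 1) := by
      ring
    linarith

theorem proposition2p2 (n : ℕ) (hn : 1 ≤ n) (d ℓ : ℝ) (hd : 0 < d) (hℓ : 0 < ℓ) :
    ∃ C : ℝ, 0 < C ∧
      ∀ (X Y E : Set (Cn n)),
        MeasurableSet X → MeasurableSet Y → MeasurableSet E →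
        Y ⊆ X → E ⊆ Y → 0 < volume E →
        ∀ D : Cn n ≃ᵃ[ℂ] Cn n,
          Metric.diam (D '' Y) = 1 / 4 →
          ENNReal.ofReal ℓ ≤ volume (D '' Y) →
          BoundarySeparated d (D '' X) (D '' Y) →
          LiesInOneComponent d (D '' X) (D '' Y) →
          ∀ f : Cn n → ℂ, MemBergman2 X f →
            l2Avg f Y ≤
              C * Real.exp (C * (doublingIndex f X Y + 1) * sStar E Y) * l2Avg f E := by
  obtain ⟨C, hC, hmain⟩ := exists_l2Avg_remez_const n hn d ℓ hd hℓ
  refine ⟨2 * C, by positivity, ?_⟩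
  rintro X Y E hX hY hE hYX hEY hE0 D hdiam hDℓ - hcomp f ⟨hhol, hmem⟩
  obtain ⟨κ, hκ, hvol⟩ := exists_volume_image_affineEquiv D
  set H : Cn n ≃ₜ Cn n := D.toContinuousAffineEquiv.toHomeomorph with hH
  have hHvol : ∀ S : Set (Cn n), volume (H '' S) = ENNReal.ofReal κ * volume S := hvol
  have hnorm : ∀ S : Set (Cn n), l2Norm (f ∘ H.symm) (H '' S) = κ ^ ((1 : ℝ) / 2) * l2Norm f S :=
    fun S => (l2Norm_comp_symm_image hκ hHvol f S).2
  have hvolr : ∀ S : Set (Cn n), (volume (H '' S)).toReal = κ * (volume S).toReal := fun S => by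
    rw [hHvol, ENNReal.toReal_mul, ENNReal.toReal_ofReal hκ.le]
  have havg : ∀ S : Set (Cn n), l2Avg (f ∘ H.symm) (H '' S) = l2Avg f S := fun S => by
    rw [l2Avg, l2Avg, hnorm, hvolr, Real.mul_rpow hκ.le ENNReal.toReal_nonneg,
      mul_div_mul_left _ _ (by positivity)]
  have hdens : density (H '' E) (H '' Y) = density E Y := by
    rw [density, density, hvolr, hvolr, mul_div_mul_left _ _ hκ.ne']
  have hN : doublingIndex (f ∘ H.symm) (H '' X) (H '' Y) = doublingIndex f X Y := by
    rw [doublingIndex, doublingIndex, hnorm, hnorm, mul_div_mul_left _ _ (by positivity)]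
  have hberg : MemBergman2 (H '' X) (f ∘ H.symm) := by
    constructor
    · rw [← H.image_interior]
      have hdiff : Differentiable ℂ H.symm :=
        (D.toContinuousAffineEquiv.symm : Cn n →ᴬ[ℂ] Cn n).differentiable
      refine hhol.comp hdiff.differentiableOn ?_
      rintro _ ⟨x, hx, rfl⟩
      rwa [H.symm_apply_apply]
    · rw [(l2Norm_comp_symm_image hκ hHvol f X).1]
      refine MemLp.smul_measure ?_ ENNReal.ofReal_ne_top
      rw [H.measurableEmbedding.memLp_map_measure_iff, Function.comp_assoc, H.symm_comp_self,
        Function.comp_id]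
      exact hmem
  have hE0' : 0 < volume (H '' E) := by
    rw [hHvol]
    exact ENNReal.mul_pos (by simpa using hκ) hE0.ne'
  have key := hmain (H '' X) (H '' Y) (H '' E) (H.measurableEmbedding.measurableSet_image.2 hY)
    (H.measurableEmbedding.measurableSet_image.2 hE) (Set.image_mono hYX)
    (Set.image_mono hEY) hE0' hdiam hDℓ hcomp (f ∘ H.symm) hberg
  rw [havg, havg, hdens, hN] at key
  have hYtop : volume Y ≠ ⊤ := by
    obtain ⟨c, W, -, hYW, hW⟩ := hcomp
    have hlt : volume (D '' Y) < ⊤ :=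
      (measure_mono fun x hx => (hW (hYW hx)).2.1).trans_lt (measure_closedBall_lt_top (x := c))
    rw [hvol] at hlt
    exact (ENNReal.lt_top_of_mul_ne_top_right hlt.ne (by simpa using hκ)).ne
  have hEtop : volume E ≠ ⊤ := ((measure_mono hEY).trans_lt hYtop.lt_top).ne
  have hYpos : 0 < (volume Y).toReal :=
    ENNReal.toReal_pos (hE0.trans_le (measure_mono hEY)).ne' hYtop
  have hδpos : 0 < density E Y := div_pos (ENNReal.toReal_pos hE0.ne' hEtop) hYpos
  have hδ1 : density E Y ≤ 1 :=
    (div_le_one hYpos).2 (ENNReal.toReal_mono hYtop (measure_mono hEY))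
  have hS := one_add_log_inv_density_le_two_mul_sStar hn hδpos hδ1
  rcases (l2Norm_nonneg f Y).eq_or_lt with hzero | hpos
  · have : l2Avg f Y = 0 := by rw [l2Avg, ← hzero, zero_div]
    rw [this]
    exact mul_nonneg (by positivity) (l2Avg_nonneg f E)
  have hN0 : 0 ≤ doublingIndex f X Y :=
    Real.log_nonneg ((one_le_div hpos).2 (l2Norm_mono hYX hmem))
  refine key.trans (mul_le_mul_of_nonneg_right ?_ (l2Avg_nonneg f E))
  refine mul_le_mul (by linarith) (Real.exp_le_exp.2 ?_) (by positivity) (by positivity)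
  calc C * (doublingIndex f X Y + 1) * (1 + Real.log (1 / density E Y))
      ≤ C * (doublingIndex f X Y + 1) * (2 * sStar E Y) := by gcongr
    _ = 2 * C * (doublingIndex f X Y + 1) * sStar E Y := by ring
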